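/- Let $k$ be a field (for instance $k=\mathbb{C}$) and $G$ a finite group. Let $D(G)$ be the quantum double: the bialgebra with basis $\delta_g\otimes h$ ($g,h\in G$), product $(\delta_g\otimes h)(\delta_u\otimes v)=\delta_{g,huh^{-1}}\,\delta_g\otimes hv$, unit $\sum_g\delta_g\otimes e$, coproduct $\Delta(\delta_g\otimes h)=\sum_{ab=g}(\delta_a\otimes h)\otimes(\delta_b\otimes h)$ and counit $\epsilon(\delta_g\otimes h)=\delta_{g,e}$. Let $BD(G)$ be its transmutation, a braided Hopf algebra whose underlying algebra is that of $D(G)$. For each conjugacy class $\mathcal{C}$ of $G$ fix a representative $r\in\mathcal{C}$, with centraliser $C_G$, and elements $q_c\in G$ $(c\in\mathcal{C})$ with $q_c r q_c^{-1}=c$ and $q_r=e$, and put $\zeta_c(h)=q_{hch^{-1}}^{-1}\,h\,q_c\in C_G$. For an irreducible representation $\pi$ of $C_G$ over $k$ on a space $V_\pi$ with basis $(v_i)$, let $V_{\mathcal{C},\pi}=k\mathcal{C}\otimes V_\pi$ with basis $E_{ci}=c\otimes v_i$ be the $D(G)$-module $$(\delta_g\otimes h)\triangleright(d\otimes w)=\delta_{g,hdh^{-1}}\;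 hdh^{-1}\otimes\pi(\zeta_d(h))w .$$ Let $S$ be a finite (possibly empty) collection of pairwise distinct pairs $(\mathcal{C},\pi)\neq(\{e\},1)$, with $\pi$ taken up to isomorphism. Let $V=\bigoplus_{(\mathcal{C},\pi)\in S}V_{\mathcal{C},\pi}$, let $\rho:D(G)\to\mathrm{End}(V)$ be the resulting representation, and let $\mathcal{L}=\bigoplus_{(\mathcal{C},\pi)\in S}\mathrm{End}(V_{\mathcal{C},\pi})$ with basis the matrix units $E_{ai}{}^{bj}=E_{ai}\otimes E^{bj}$ of all the blocks. $\mathcal{L}$ is a braided Lie algebra in the category of $G$-crossed modules, where (summing over repeated representation indices, and with pairs of basis elements allowed to lie in different blocks) - the $G$-action is $h\triangleright E_{ai}{}^{bj}=\pi(\zeta_a(h))^m{}_i\,\pi(\zeta_b(h)^{-1})^j{}_l\,E_{(hah^{-1})m}{}^{(hbh^{-1})l}$, the degree is $|E_{ai}{}^{bj}|=ab^{-1}$, and the braiding is $\Psi(x\otimes y)=|x|\triangleright y\otimes x$; - the coproduct is $\Delta E_{ai}{}^{bj}=\sum_{c}E_{ai}{}^{cm}\otimes E_{cm}{}^{bj}$;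 - the bracket is $[E_{ai}{}^{bj},E_{cm}{}^{dl}]=\delta_{ab^{-1}cd^{-1},\,g}\;\pi(\zeta_a(g^{-1}))^j{}_i\; b^{-1}\triangleright E_{cm}{}^{dl}$ with $g=b^{-1}cd^{-1}b$. Let $\widetilde\Psi=([\ ,\ ]\otimes\mathrm{id})(\mathrm{id}\otimes\Psi)(\Delta\otimes\mathrm{id})$ be its fundamental braiding, and let $U(\mathcal{L})$ be the quotient of the tensor algebra $T(\mathcal{L})$ by the relations $\cdot\circ\widetilde\Psi=\cdot$ on $\mathcal{L}\otimes\mathcal{L}$. There is a unique algebra map $U(\mathcal{L})\to BD(G)$ with $$E_{ai}{}^{bj}\longmapsto r_{ai}{}^{bj}:=\sum_{n\in C_G}\pi(n)^j{}_i\;\delta_{q_a n^{-1}q_b^{-1}}\otimes b^{-1}.$$ **Lemma.** The map $U(\mathcal{L})\to BD(G)$ is surjective if and only if $\rho$ is inner faithful, i.e. $\rho$ does not factor through any proper bialgebra quotient of $D(G)$: every surjective bialgebra map $p:D(G)\to B$ for which $\rho=f\circ p$ for some algebra map $f:B\to\mathrm{End}(V)$ is injective. -/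

import Mathlib

open scoped TensorProduct

set_option linter.unusedSectionVars false

noncomputable section

namespace QuantumDouble

/-! ### The quantum double of a finite group -/

/-- The underlying vector space `k(G) ⊗ kG` of the quantum double `D(G)`; the function `x` stands
for `∑ g h, x (g, h) • (δ_g ⊗ h)`. -/
def DG (k G : Type*) : Type _ := G × G → k

section DG

variable {k G : Type*} [Field k] [Group G] [Fintype G] [DecidableEq G]

instance : AddCommGroup (DG k G) := inferInstanceAs (AddCommGroup (G × G → k))

instance : Module k (DG k G) := inferInstanceAs (Module k (G × G → k))

/-- The basis `δ_g ⊗ h` of `D(G)`. -/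
def dgBasis (k G : Type*) [Field k] [Fintype G] : Module.Basis (G × G) k (DG k G) :=
  Pi.basisFun k (G × G)

/-- The element `δ_g ⊗ h` of `D(G)`. -/
def dg (k : Type*) {G : Type*} [Field k] [Fintype G] (g h : G) : DG k G := dgBasis k G (g, h)

theorem dg_apply (g h : G) (p : G × G) :
    (dg k g h : DG k G) p = if p.1 = g ∧ p.2 = h then 1 else 0 := by
  have : (dg k g h : DG k G) = (Pi.single (g, h) (1 : k) : G × G → k) := by
    unfold dg dgBasis
    exact Pi.basisFun_apply k (G × G) (g, h)
  rw [this, Pi.single_apply]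
  simp [Prod.ext_iff]

theorem DG.ext {x y : DG k G} (h : ∀ g u, x (g, u) = y (g, u)) : x = y :=
  funext fun p => h p.1 p.2

theorem DG.add_apply (x y : DG k G) (p : G × G) : (x + y) p = x p + y p := rfl

theorem DG.smul_apply (c : k) (x : DG k G) (p : G × G) : (c • x) p = c * x p := rfl

theorem DG.zero_apply (p : G × G) : (0 : DG k G) p = 0 := rfl

theorem DG.sum_apply {ι : Type*} (s : Finset ι) (f : ι → DG k G) (p : G × G) :
    (∑ i ∈ s, f i) p = ∑ i ∈ s, f i p :=
  Finset.sum_apply p s (fun i => (f i : G × G → k))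

/-- The product of `D(G)`, see `dg_mul_dg` for its values on the basis. -/
instance : Mul (DG k G) where
  mul x y := fun p => ∑ v : G, x (p.1, v) * y (v⁻¹ * p.1 * v, v⁻¹ * p.2)

/-- The unit of `D(G)` is `∑ g, δ_g ⊗ e`. -/
instance : One (DG k G) where
  one := fun p => if p.2 = 1 then 1 else 0

theorem DG.mul_apply (x y : DG k G) (g h : G) :
    (x * y) (g, h) = ∑ v : G, x (g, v) * y (v⁻¹ * g * v, v⁻¹ * h) := rfl

theorem DG.one_apply (g h : G) : (1 : DG k G) (g, h) = if h = 1 then 1 else 0 := rfl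

instance : Ring (DG k G) where
  __ := (inferInstance : AddCommGroup (DG k G))
  left_distrib x y z := by
    refine DG.ext fun g h => ?_
    simp [DG.mul_apply, DG.add_apply, mul_add, Finset.sum_add_distrib]
  right_distrib x y z := by
    refine DG.ext fun g h => ?_
    simp [DG.mul_apply, DG.add_apply, add_mul, Finset.sum_add_distrib]
  zero_mul x := by
    refine DG.ext fun g h => ?_
    simp [DG.mul_apply, DG.zero_apply]
  mul_zero x := by
    refine DG.ext fun g h => ?_
    simp [DG.mul_apply, DG.zero_apply]
  one_mul x := by
    refine DG.ext fun g h => ?_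
    simp [DG.mul_apply, DG.one_apply]
  mul_one x := by
    refine DG.ext fun g h => ?_
    simp [DG.mul_apply, DG.one_apply, inv_mul_eq_one]
  mul_assoc x y z := by
    refine DG.ext fun g h => ?_
    simp only [DG.mul_apply, Finset.sum_mul, Finset.mul_sum]
    rw [Finset.sum_comm]
    refine Finset.sum_congr rfl fun v _ => ?_
    refine Fintype.sum_equiv (Equiv.mulLeft v⁻¹) _ _ fun w => ?_
    simp [mul_assoc]

instance : Algebra k (DG k G) :=
  Algebra.ofModule
    (fun c x y => DG.ext fun g h => by
      simp [DG.mul_apply, DG.smul_apply, Finset.mul_sum, mul_assoc])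
    (fun c x y => DG.ext fun g h => by
      simp [DG.mul_apply, DG.smul_apply, Finset.mul_sum, mul_left_comm])

theorem dg_mul_dg (g h u v : G) :
    (dg k g h : DG k G) * dg k u v = if g = h * u * h⁻¹ then dg k g (h * v) else 0 := by
  refine DG.ext fun a b => ?_
  have key : (a = g ∧ h⁻¹ * a * h = u ∧ h⁻¹ * b = v) ↔ (g = h * u * h⁻¹ ∧ a = g ∧ b = h * v) := by
    constructor
    · rintro ⟨rfl, rfl, rfl⟩
      simp [mul_assoc]
    · rintro ⟨rfl, rfl, rfl⟩
      simp [mul_assoc]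
  have h1 : ((dg k g h : DG k G) * dg k u v) (a, b)
      = if (a = g ∧ h⁻¹ * a * h = u ∧ h⁻¹ * b = v) then 1 else 0 := by
    rw [DG.mul_apply, Finset.sum_eq_single h]
    · simp only [dg_apply]
      by_cases h1 : a = g <;> simp [h1]
    · intro w _ hw
      simp [dg_apply, hw]
    · simp
  rw [h1]
  by_cases h2 : g = h * u * h⁻¹
  · rw [if_pos h2, dg_apply]
    simp only [key]
    by_cases h3 : a = g ∧ b = h * v
    · rw [if_pos ⟨h2, h3⟩, if_pos h3]
    · rw [if_neg (fun h4 => h3 h4.2), if_neg h3]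
  · rw [if_neg h2, DG.zero_apply, if_neg]
    rw [key]
    exact fun h4 => h2 h4.1

theorem one_eq_sum_dg : (1 : DG k G) = ∑ g : G, dg k g 1 := by
  refine DG.ext fun a b => ?_
  rw [DG.sum_apply, DG.one_apply, Finset.sum_eq_single a]
  · simp [dg_apply]
  · intro w _ hw
    simp [dg_apply, hw.symm]
  · simp

/-- The coproduct `Δ(δ_g ⊗ h) = ∑_{ab = g} (δ_a ⊗ h) ⊗ (δ_b ⊗ h)` of `D(G)`. -/
def dgComul (k G : Type*) [Field k] [Group G] [Fintype G] :
    DG k G →ₗ[k] DG k G ⊗[k] DG k G :=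
  (dgBasis k G).constr k fun p => ∑ a : G, dg k a p.2 ⊗ₜ[k] dg k (a⁻¹ * p.1) p.2

/-- The counit `ε(δ_g ⊗ h) = δ_{g,e}` of `D(G)`. -/
def dgCounit (k G : Type*) [Field k] [Group G] [Fintype G] [DecidableEq G] : DG k G →ₗ[k] k :=
  (dgBasis k G).constr k fun p => if p.1 = 1 then 1 else 0

theorem dgComul_dg (g h : G) :
    dgComul k G (dg k g h) = ∑ a : G, dg k a h ⊗ₜ[k] dg k (a⁻¹ * g) h :=
  (dgBasis k G).constr_basis k _ (g, h)

theorem dgCounit_dg (g h : G) : dgCounit k G (dg k g h) = if g = 1 then 1 else 0 :=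
  (dgBasis k G).constr_basis k _ (g, h)

instance : Coalgebra k (DG k G) where
  comul := dgComul k G
  counit := dgCounit k G
  coassoc := by
    refine (dgBasis k G).ext fun ⟨g, h⟩ => ?_
    change (TensorProduct.assoc k _ _ _) ((dgComul k G).rTensor _ (dgComul k G (dg k g h)))
      = (dgComul k G).lTensor _ (dgComul k G (dg k g h))
    simp only [dgComul_dg, map_sum, LinearMap.rTensor_tmul, LinearMap.lTensor_tmul,
      TensorProduct.sum_tmul, TensorProduct.tmul_sum, TensorProduct.assoc_tmul]
    rw [Finset.sum_comm]
    refine Finset.sum_congr rfl fun a _ => ?_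
    refine Fintype.sum_equiv (Equiv.mulLeft a⁻¹) _ _ fun b => ?_
    simp [mul_assoc]
  rTensor_counit_comp_comul := by
    refine (dgBasis k G).ext fun ⟨g, h⟩ => ?_
    change (dgCounit k G).rTensor _ (dgComul k G (dg k g h)) = 1 ⊗ₜ[k] dg k g h
    simp only [dgComul_dg, map_sum, LinearMap.rTensor_tmul, dgCounit_dg]
    rw [Finset.sum_eq_single 1]
    · simp
    · intro a _ ha
      simp [ha]
    · simp
  lTensor_counit_comp_comul := by
    refine (dgBasis k G).ext fun ⟨g, h⟩ => ?_
    change (dgCounit k G).lTensor _ (dgComul k G (dg k g h)) = dg k g h ⊗ₜ[k] 1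
    simp only [dgComul_dg, map_sum, LinearMap.lTensor_tmul, dgCounit_dg]
    rw [Finset.sum_eq_single g]
    · simp
    · intro a _ ha
      have : a⁻¹ * g ≠ 1 := fun h0 => ha (inv_mul_eq_one.mp h0)
      simp [this]
    · simp

instance : Bialgebra k (DG k G) where
  counit_one := by
    change dgCounit k G 1 = 1
    rw [one_eq_sum_dg]
    simp [dgCounit_dg]
  mul_compr₂_counit := by
    refine (dgBasis k G).ext fun ⟨g, h⟩ => (dgBasis k G).ext fun ⟨u, v⟩ => ?_
    change dgCounit k G (dg k g h * dg k u v) = dgCounit k G (dg k g h) * dgCounit k G (dg k u v)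
    rw [dg_mul_dg, apply_ite (dgCounit k G), dgCounit_dg, dgCounit_dg, dgCounit_dg, map_zero]
    by_cases hu : u = 1
    · subst hu
      by_cases hg : g = 1 <;> simp [hg]
    · by_cases hg : g = h * u * h⁻¹
      · have : g ≠ 1 := by
          rw [hg]
          simpa using hu
        simp [this]
      · simp [hu, hg]
  comul_one := by
    change dgComul k G 1 = 1 ⊗ₜ[k] 1
    rw [one_eq_sum_dg]
    simp only [map_sum, dgComul_dg, TensorProduct.sum_tmul, TensorProduct.tmul_sum]
    rw [Finset.sum_comm]
    conv_rhs => rw [Finset.sum_comm]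
    refine Finset.sum_congr rfl fun a _ => ?_
    exact Fintype.sum_equiv (Equiv.mulLeft a⁻¹) _ _ fun b => rfl
  mul_compr₂_comul := by
    refine (dgBasis k G).ext fun ⟨g, h⟩ => (dgBasis k G).ext fun ⟨u, v⟩ => ?_
    change dgComul k G (dg k g h * dg k u v) = dgComul k G (dg k g h) * dgComul k G (dg k u v)
    rw [dg_mul_dg, apply_ite (dgComul k G), dgComul_dg, dgComul_dg, dgComul_dg, map_zero,
      Finset.sum_mul]
    simp only [Finset.mul_sum, Algebra.TensorProduct.tmul_mul_tmul, dg_mul_dg]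
    have : ∀ a : G, (∑ b : G, (if a = h * b * h⁻¹ then dg k a (h * v) else (0 : DG k G)) ⊗ₜ[k]
        (if a⁻¹ * g = h * (b⁻¹ * u) * h⁻¹ then dg k (a⁻¹ * g) (h * v) else (0 : DG k G)))
        = if g = h * u * h⁻¹ then dg k a (h * v) ⊗ₜ[k] dg k (a⁻¹ * g) (h * v) else 0 := by
      intro a
      rw [Finset.sum_eq_single (h⁻¹ * a * h)]
      · have e1 : a = h * (h⁻¹ * a * h) * h⁻¹ := by group
        have e2 : a⁻¹ * g = h * ((h⁻¹ * a * h)⁻¹ * u) * h⁻¹ ↔ g = h * u * h⁻¹ := by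
          have : h * ((h⁻¹ * a * h)⁻¹ * u) * h⁻¹ = a⁻¹ * (h * u * h⁻¹) := by group
          rw [this, mul_right_inj]
        rw [if_pos e1]
        simp only [e2]
        split_ifs <;> simp
      · intro b _ hb
        have : a ≠ h * b * h⁻¹ := by
          rintro rfl
          exact hb (by group)
        simp [this]
      · simp
    simp only [this]
    split_ifs <;> simp

end DG

/-! ### Blocks -/

/-- The choices made once and for all for the group `G`: a representative `r C` of every conjugacy
class `C`, and elements `q c` with `q c * r C * (q c)⁻¹ = c` for `c ∈ C`, where `q (r C) = e`. -/
structure Transversal (G : Type*) [Group G] where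
  r : ConjClasses G → G
  mk_r : ∀ C, ConjClasses.mk (r C) = C
  q : G → G
  q_conj : ∀ c, q c * r (ConjClasses.mk c) * (q c)⁻¹ = c
  q_r : ∀ C, q (r C) = 1

universe u v w

/-- A pair `(C, π)` of a conjugacy class `C` of `G` and an irreducible representation `π` of the
centraliser of the representative of `C`, with a basis `v` of the carrier space of `π`. -/
structure Block (k : Type u) {G : Type v} [Field k] [Group G] (T : Transversal G) where
  C : ConjClasses G
  V : Type w
  [addCommGroup : AddCommGroup V]
  [module : Module k V]
  π : Representation k (Subgroup.centralizer {T.r C}) V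
  irreducible : π.IsIrreducible
  dim : ℕ
  v : Module.Basis (Fin dim) k V

attribute [instance] Block.addCommGroup Block.module

section Block

variable {k : Type u} {G : Type v} [Field k] [Group G] [Fintype G] [DecidableEq G]
  {T : Transversal G}

namespace Block

/-- The pair `({e}, 1)` with `1` the trivial representation. -/
def IsTrivial (X : Block.{u, v, w} k T) : Prop :=
  X.C = ConjClasses.mk 1 ∧ ∀ n, X.π n = LinearMap.id

/-- Two pairs `(C, π)` are identified when the classes agree and the representations are
isomorphic. -/
def Iso (X Y : Block.{u, v, w} k T) : Prop :=
  ∃ (h : X.C = Y.C) (e : X.V ≃ₗ[k] Y.V),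
    ∀ (n : Subgroup.centralizer {T.r X.C}) (x : X.V), e (X.π n x) = Y.π ⟨n, h ▸ n.2⟩ (e x)

/-- The matrix entry `π(n)^i_j` in the basis `v`. -/
def coef (X : Block.{u, v, w} k T) (n : Subgroup.centralizer {T.r X.C}) (i j : Fin X.dim) : k :=
  X.v.repr (X.π n (X.v j)) i

/-- The elements of the conjugacy class `C`. -/
@[ext]
structure Cl (X : Block.{u, v, w} k T) : Type v where
  val : G
  mk_val : ConjClasses.mk val = X.C

variable (X : Block.{u, v, w} k T)

instance : DecidableEq X.Cl := fun c d => decidable_of_iff (c.val = d.val) Cl.ext_iff.symm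

instance : Finite X.Cl := Finite.of_injective Cl.val fun _ _ h => Cl.ext h

instance : Fintype X.Cl := Fintype.ofFinite _

instance : Fintype (Subgroup.centralizer {T.r X.C}) := Fintype.ofFinite _

variable {X}

/-- The element `h c h⁻¹` of the class. -/
def Cl.conj (h : G) (c : X.Cl) : X.Cl :=
  ⟨h * c.1 * h⁻¹, by
    refine Eq.trans ?_ c.2
    rw [ConjClasses.mk_eq_mk_iff_isConj]
    exact (isConj_iff.mpr ⟨h, rfl⟩ : IsConj c.1 (h * c.1 * h⁻¹)).symm⟩

theorem Cl.conj_val (h : G) (c : X.Cl) : (c.conj h).1 = h * c.1 * h⁻¹ := rfl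

theorem Cl.conj_conj (h g : G) (c : X.Cl) : (c.conj g).conj h = c.conj (h * g) :=
  Cl.ext (by simp [Cl.conj_val, mul_assoc])

theorem Cl.q_mul_r (c : X.Cl) : T.q c.1 * T.r X.C = c.1 * T.q c.1 := by
  have := T.q_conj c.1
  rw [c.2, mul_inv_eq_iff_eq_mul] at this
  exact this

/-- The cocycle `ζ_c(h) = q_{h c h⁻¹}⁻¹ h q_c`, with values in the centraliser. -/
def zeta (c : X.Cl) (h : G) : Subgroup.centralizer {T.r X.C} :=
  ⟨(T.q (c.conj h).1)⁻¹ * h * T.q c.1, by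
    rw [Subgroup.mem_centralizer_singleton_iff]
    have h1 := (c.conj h).q_mul_r
    have h2 := c.q_mul_r
    rw [Cl.conj_val] at *
    rw [← mul_left_cancel_iff (a := T.q (h * c.1 * h⁻¹))]
    symm
    calc T.q (h * c.1 * h⁻¹) * (T.r X.C * ((T.q (h * c.1 * h⁻¹))⁻¹ * h * T.q c.1))
        = (T.q (h * c.1 * h⁻¹) * T.r X.C) * ((T.q (h * c.1 * h⁻¹))⁻¹ * h * T.q c.1) := by group
      _ = h * (c.1 * T.q c.1) := by rw [h1]; group
      _ = _ := by rw [← h2]; group⟩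

theorem zeta_val (c : X.Cl) (h : G) :
    (zeta c h : G) = (T.q (c.conj h).1)⁻¹ * h * T.q c.1 := rfl

theorem zeta_mul (c : X.Cl) (h g : G) : zeta (c.conj g) h * zeta c g = zeta c (h * g) := by
  apply Subtype.ext
  rw [Subgroup.coe_mul, zeta_val, zeta_val, zeta_val, Cl.conj_conj]
  group

theorem zeta_one (c : X.Cl) : zeta c 1 = 1 := by
  apply Subtype.ext
  have : c.conj 1 = c := Cl.ext (by simp [Cl.conj_val])
  rw [zeta_val, this]
  simp

theorem coef_mul (n m : Subgroup.centralizer {T.r X.C}) (i j : Fin X.dim) :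
    X.coef (n * m) i j = ∑ l, X.coef n i l * X.coef m l j := by
  have h1 : X.π m (X.v j) = ∑ l, X.coef m l j • X.v l := (X.v.sum_repr _).symm
  have h2 : X.π (n * m) (X.v j) = ∑ l, X.coef m l j • X.π n (X.v l) := by
    rw [map_mul, Module.End.mul_apply, h1, map_sum]
    simp
  rw [coef, h2]
  simp [coef, Finsupp.finsetSum_apply, mul_comm]

theorem coef_one (i j : Fin X.dim) : X.coef 1 i j = if i = j then 1 else 0 := by
  simp [coef, Finsupp.single_apply, eq_comm]

variable (X)

/-- The index set of the basis `E_{ci} = c ⊗ v_i` of `V_{C,π}`. -/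
abbrev Pt : Type v := X.Cl × Fin X.dim

/-- The matrix of `δ_g ⊗ h` acting on `V_{C,π}`, with entry
`δ_{g,c} δ_{c, h d h⁻¹} π(ζ_d(h))^i_j` in row `ci` and column `dj`. -/
def mat (g h : G) : Matrix X.Pt X.Pt k :=
  Matrix.of fun a b => if g = a.1.1 ∧ a.1 = b.1.conj h then X.coef (zeta b.1 h) a.2 b.2 else 0

theorem mat_mul_mat (g h u v : G) :
    X.mat g h * X.mat u v = if g = h * u * h⁻¹ then X.mat g (h * v) else 0 := by
  ext ⟨a, i⟩ ⟨b, j⟩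
  rw [Matrix.mul_apply, Fintype.sum_prod_type, Finset.sum_eq_single (b.conj v)]
  · simp only [mat, Matrix.of_apply]
    by_cases h1 : g = a.1 ∧ a = (b.conj v).conj h
    · obtain ⟨rfl, rfl⟩ := h1
      have e : ((b.conj v).conj h).1 = h * u * h⁻¹ ↔ u = (b.conj v).1 := by
        rw [Cl.conj_val, mul_left_inj, mul_right_inj, eq_comm]
      by_cases h2 : u = (b.conj v).1
      · rw [if_pos (e.mpr h2)]
        simp only [h2, Matrix.of_apply, and_self, if_true, Cl.conj_conj]
        rw [← zeta_mul, coef_mul]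
      · rw [if_neg (fun h => h2 (e.mp h))]
        simp [h2]
    · have : ∀ p : k, (if g = h * u * h⁻¹ then X.mat g (h * v) else 0) (a, i) (b, j) = 0 := by
        intro _
        split_ifs
        · simp only [mat, Matrix.of_apply]
          rw [Cl.conj_conj] at h1
          exact if_neg h1
        · rfl
      simp only [mat] at this
      rw [this 0]
      simp [h1]
  · intro c _ hc
    simp [mat, hc]
  · simp

theorem sum_mat_one : ∑ g : G, X.mat g 1 = 1 := by
  ext ⟨a, i⟩ ⟨b, j⟩
  have e : b.conj 1 = b := Cl.ext (by simp [Cl.conj_val])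
  rw [Matrix.sum_apply, Finset.sum_eq_single a.1]
  · simp only [mat, Matrix.of_apply, e, zeta_one, coef_one, Matrix.one_apply, Prod.mk.injEq]
    by_cases h : a = b <;> simp [h]
  · intro c _ hc
    simp [mat, hc]
  · simp

/-- The irreducible representation `ρ_{C,π} : D(G) → End(V_{C,π})`, in matrix form. -/
def rho : DG k G →ₐ[k] Matrix X.Pt X.Pt k :=
  AlgHom.ofLinearMap ((dgBasis k G).constr k fun p => X.mat p.1 p.2)
    (by
      rw [one_eq_sum_dg, map_sum, ← sum_mat_one]
      exact Finset.sum_congr rfl fun g _ => (dgBasis k G).constr_basis k _ (g, 1))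
    (by
      set f := (dgBasis k G).constr k fun p => X.mat p.1 p.2 with hf
      have hb : ∀ g h, f (dg k g h) = X.mat g h := fun g h => (dgBasis k G).constr_basis k _ (g, h)
      have : (LinearMap.mul k (DG k G)).compr₂ f = (LinearMap.mul k _).compl₁₂ f f := by
        refine (dgBasis k G).ext fun ⟨g, h⟩ => (dgBasis k G).ext fun ⟨u, v⟩ => ?_
        change f (dg k g h * dg k u v) = f (dg k g h) * f (dg k u v)
        rw [dg_mul_dg, hb, hb, mat_mul_mat, apply_ite f, hb, map_zero]
      exact fun x y => LinearMap.congr_fun₂ this x y)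

/-- The element `r_{ai}^{bj} = ∑ n, π(n)^j_i δ_{q_a n⁻¹ q_b⁻¹} ⊗ b⁻¹`, for the index pairs
`a = (a, i)` and `b = (b, j)`. -/
def rElem (a b : X.Pt) : DG k G :=
  ∑ n : Subgroup.centralizer {T.r X.C},
    X.coef n b.2 a.2 • dg k (T.q a.1.1 * (n : G)⁻¹ * (T.q b.1.1)⁻¹) b.1.1⁻¹

theorem rElem_apply (a b : X.Pt) (g h : G) :
    X.rElem a b (g, h) =
      if h = b.1.1⁻¹ ∧ a.1.conj g⁻¹ = b.1 then X.coef (zeta a.1 g⁻¹) b.2 a.2 else 0 := by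
  rw [rElem, DG.sum_apply]
  simp only [DG.smul_apply, dg_apply]
  by_cases hh : h = b.1.1⁻¹
  · by_cases hc : a.1.conj g⁻¹ = b.1
    · rw [if_pos ⟨hh, hc⟩, Finset.sum_eq_single (zeta a.1 g⁻¹)]
      · rw [if_pos, mul_one]
        refine ⟨?_, hh⟩
        rw [zeta_val, hc]
        group
      · intro n _ hn
        rw [if_neg, mul_zero]
        rintro ⟨h1, -⟩
        apply hn
        apply Subtype.ext
        rw [zeta_val, hc, h1]
        group
      · simp
    · rw [if_neg (fun h => hc h.2)]
      refine Finset.sum_eq_zero fun n _ => ?_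
      rw [if_neg, mul_zero]
      rintro ⟨h1, -⟩
      apply hc
      apply Cl.ext
      have hn : (n : G) * T.r X.C = T.r X.C * n :=
        Subgroup.mem_centralizer_singleton_iff.mp n.2
      have h2 := a.1.q_mul_r
      have h3 := b.1.q_mul_r
      rw [Cl.conj_val, h1]
      have h4 : a.1.1 = T.q a.1.1 * T.r X.C * (T.q a.1.1)⁻¹ := by rw [h2]; group
      have h5 : b.1.1 = T.q b.1.1 * T.r X.C * (T.q b.1.1)⁻¹ := by rw [h3]; group
      calc _ = T.q b.1.1 * n * (T.q a.1.1)⁻¹ * a.1.1 * T.q a.1.1 * (n : G)⁻¹ * (T.q b.1.1)⁻¹ := by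
            group
        _ = T.q b.1.1 * n * (T.q a.1.1)⁻¹ * (a.1.1 * T.q a.1.1) * (n : G)⁻¹ * (T.q b.1.1)⁻¹ := by
            group
        _ = T.q b.1.1 * (n * T.r X.C) * (n : G)⁻¹ * (T.q b.1.1)⁻¹ := by rw [← h2]; group
        _ = T.q b.1.1 * T.r X.C * (T.q b.1.1)⁻¹ := by rw [hn]; group
        _ = _ := h5.symm
  · simp [hh]

end Block

/-! ### The braided Lie algebra of a family of blocks -/

variable {σ : Type*} [Fintype σ] [DecidableEq σ] (S : σ → Block.{u, v, w} k T)

/-- The space `V = ⨁ V_{C,π}` in the bases `E_{ci}`. -/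
abbrev VSum : Type _ := ∀ s, (S s).Pt → k

/-- The representation `ρ : D(G) → End(V)` on the direct sum of the blocks. -/
def rhoSum : DG k G →ₐ[k] Module.End k (VSum S) where
  toFun x := LinearMap.pi fun s => (Matrix.mulVecLin ((S s).rho x)).comp (LinearMap.proj s)
  map_one' := by
    refine LinearMap.ext fun f => funext fun s => ?_
    simp
  map_mul' x y := by
    refine LinearMap.ext fun f => funext fun s => ?_
    simp
  map_zero' := by
    refine LinearMap.ext fun f => funext fun s => ?_
    simp
  map_add' x y := by
    refine LinearMap.ext fun f => funext fun s => ?_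
    simp
  commutes' c := by
    refine LinearMap.ext fun f => funext fun s => ?_
    simp [Algebra.algebraMap_eq_smul_one]

/-- The underlying space of `𝓛 = ⨁ End(V_{C,π})`, each summand in matrix form. -/
abbrev LieSum : Type _ := ∀ s, Matrix (S s).Pt (S s).Pt k

/-- The basis of `𝓛` formed by the matrix units of all the blocks. -/
def lieBasis : Module.Basis (Σ s, (S s).Pt × (S s).Pt) k (LieSum S) :=
  Pi.basis fun s => Matrix.stdBasis k (S s).Pt (S s).Pt

/-- The basis element `E_{ai}^{bj} = E_{ai} ⊗ E^{bj}` of the block `s`, for the index pairs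
`a = (a, i)` and `b = (b, j)`. -/
def E (s : σ) (a b : (S s).Pt) : LieSum S := lieBasis S ⟨s, a, b⟩

theorem E_eq (s : σ) (a b : (S s).Pt) : E S s a b = Pi.single s (Matrix.single a b 1) := by
  simp [E, lieBasis, Matrix.stdBasis_eq_single]

/-- The linear map on `𝓛` with prescribed values on the `E_{ai}^{bj}`. -/
def lieLift {M : Type*} [AddCommGroup M] [Module k M]
    (f : ∀ s, (S s).Pt → (S s).Pt → M) : LieSum S →ₗ[k] M :=
  (lieBasis S).constr k fun x => f x.1 x.2.1 x.2.2

theorem lieLift_E {M : Type*} [AddCommGroup M] [Module k M]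
    (f : ∀ s, (S s).Pt → (S s).Pt → M) (s : σ) (a b : (S s).Pt) :
    lieLift S f (E S s a b) = f s a b :=
  (lieBasis S).constr_basis k _ _

/-- The action of `h ∈ G` in the `G`-crossed module `𝓛`:
`h ▷ E_{ai}^{bj} = π(ζ_a(h))^m_i π(ζ_b(h)⁻¹)^j_l E_{(h a h⁻¹) m}^{(h b h⁻¹) l}`. -/
def lieAct (h : G) : LieSum S →ₗ[k] LieSum S :=
  lieLift S fun s a b => ∑ m : Fin (S s).dim, ∑ l : Fin (S s).dim,
    ((S s).coef (Block.zeta a.1 h) m a.2 * (S s).coef (Block.zeta b.1 h)⁻¹ b.2 l) •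
      E S s (a.1.conj h, m) (b.1.conj h, l)

/-- The degree `|E_{ai}^{bj}| = a b⁻¹` in the `G`-crossed module `𝓛`. -/
def lieDeg {S : σ → Block.{u, v, w} k T} {s : σ} (a b : (S s).Pt) : G := a.1.1 * b.1.1⁻¹

/-- The matrix coproduct `Δ E_{ai}^{bj} = ∑ E_{ai}^{cm} ⊗ E_{cm}^{bj}` of `𝓛`. -/
def lieComul : LieSum S →ₗ[k] LieSum S ⊗[k] LieSum S :=
  lieLift S fun s a b => ∑ e : (S s).Pt, E S s a e ⊗ₜ[k] E S s e b

/-- The braiding `Ψ(x ⊗ y) = |x| ▷ y ⊗ x` of `𝓛` with itself in `G`-crossed modules. -/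
def lieBraid : LieSum S ⊗[k] LieSum S →ₗ[k] LieSum S ⊗[k] LieSum S :=
  TensorProduct.lift <| lieLift S fun s a b =>
    ((TensorProduct.mk k (LieSum S) (LieSum S)).flip (E S s a b)).comp
      (lieAct S (lieDeg (S := S) a b))

/-- The braided Lie bracket of `𝓛`: with `g = |b⁻¹ ▷ E_{cm}^{dl}| = b⁻¹ c d⁻¹ b`,
`[E_{ai}^{bj}, E_{cm}^{dl}] = δ_{a b⁻¹ c d⁻¹, g} π(ζ_a(g⁻¹))^j_i b⁻¹ ▷ E_{cm}^{dl}`. -/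
def lieBracket : LieSum S ⊗[k] LieSum S →ₗ[k] LieSum S :=
  TensorProduct.lift <| lieLift S fun s a b => lieLift S fun t c d =>
    if lieDeg (S := S) a b * lieDeg (S := S) c d
        = lieDeg (S := S) (c.1.conj b.1.1⁻¹, c.2) (d.1.conj b.1.1⁻¹, d.2) then
      (S s).coef (Block.zeta a.1
        (lieDeg (S := S) (c.1.conj b.1.1⁻¹, c.2) (d.1.conj b.1.1⁻¹, d.2))⁻¹) b.2 a.2 •
        lieAct S b.1.1⁻¹ (E S t c d)
    else 0

/-- The fundamental braiding `Ψ̃ = ([ , ] ⊗ id) ∘ (id ⊗ Ψ) ∘ (Δ ⊗ id)` of the braided Lie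
algebra `𝓛`. -/
def fundBraid : LieSum S ⊗[k] LieSum S →ₗ[k] LieSum S ⊗[k] LieSum S :=
  ((lieBracket S).rTensor (LieSum S)).comp <|
    ((TensorProduct.assoc k _ _ _).symm.toLinearMap).comp <|
      ((lieBraid S).lTensor (LieSum S)).comp <|
        ((TensorProduct.assoc k _ _ _).toLinearMap).comp <|
          (lieComul S).rTensor (LieSum S)

/-- The relations `· ∘ Ψ̃ = ·` on the tensor algebra of `𝓛`. -/
inductive EnvRel : TensorAlgebra k (LieSum S) → TensorAlgebra k (LieSum S) → Prop
  | of (x y : LieSum S) :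
      EnvRel
        (LinearMap.mul' k _ (TensorProduct.map (TensorAlgebra.ι k) (TensorAlgebra.ι k)
          (fundBraid S (x ⊗ₜ[k] y))))
        (TensorAlgebra.ι k x * TensorAlgebra.ι k y)

/-- The universal enveloping algebra `U(𝓛)` of the braided Lie algebra `𝓛`, the quotient of the
tensor algebra of `𝓛` by the relations `· ∘ Ψ̃ = ·`. -/
abbrev EnvAlg : Type _ := RingQuot (EnvRel S)

/-- The inclusion of generators `𝓛 → U(𝓛)`. -/
def envOf : LieSum S →ₗ[k] EnvAlg S :=
  (RingQuot.mkAlgHom k (EnvRel S)).toLinearMap.comp (TensorAlgebra.ι k)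

/-- The underlying algebra of the braided Hopf algebra `BD(G)`, the transmutation of `D(G)`. It is
the algebra `D(G)`: transmutation changes only the coproduct. -/
abbrev BDG (k : Type u) (G : Type v) : Type _ := DG k G

/-- The linear map `𝓛 → BD(G)`, `E_{ai}^{bj} ↦ r_{ai}^{bj}`. -/
def rhoSharp : LieSum S →ₗ[k] BDG k G :=
  lieLift S fun s a b => (S s).rElem a b

theorem rhoSharp_E (s : σ) (a b : (S s).Pt) : rhoSharp S (E S s a b) = (S s).rElem a b :=
  lieLift_E S _ s a b

theorem lieAct_E (h : G) (s : σ) (a b : (S s).Pt) :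
    lieAct S h (E S s a b) = ∑ m : Fin (S s).dim, ∑ l : Fin (S s).dim,
      ((S s).coef (Block.zeta a.1 h) m a.2 * (S s).coef (Block.zeta b.1 h)⁻¹ b.2 l) •
        E S s (a.1.conj h, m) (b.1.conj h, l) :=
  lieLift_E S _ s a b

theorem lieBraid_E (s : σ) (a b : (S s).Pt) (y : LieSum S) :
    lieBraid S (E S s a b ⊗ₜ[k] y) = lieAct S (lieDeg (S := S) a b) y ⊗ₜ[k] E S s a b := by
  rw [lieBraid, TensorProduct.lift.tmul, lieLift_E]
  rfl

theorem lieBracket_E (s : σ) (a b : (S s).Pt) (t : σ) (c d : (S t).Pt) :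
    lieBracket S (E S s a b ⊗ₜ[k] E S t c d) =
      if lieDeg (S := S) a b * lieDeg (S := S) c d = b.1.1⁻¹ * lieDeg (S := S) c d * b.1.1 then
        (S s).coef (Block.zeta a.1 (b.1.1⁻¹ * lieDeg (S := S) c d * b.1.1)⁻¹) b.2 a.2 •
          lieAct S b.1.1⁻¹ (E S t c d)
      else 0 := by
  have : lieDeg (S := S) (s := t) (c.1.conj b.1.1⁻¹, c.2) (d.1.conj b.1.1⁻¹, d.2)
      = b.1.1⁻¹ * lieDeg (S := S) c d * b.1.1 := by
    simp [lieDeg, Block.Cl.conj_val, mul_assoc]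
  rw [lieBracket, TensorProduct.lift.tmul, lieLift_E, lieLift_E, this]

theorem lieAct_mul_E (h g : G) (s : σ) (a b : (S s).Pt) :
    lieAct S h (lieAct S g (E S s a b)) = lieAct S (h * g) (E S s a b) := by
  have e : (Block.zeta b.1 (h * g))⁻¹ =
      (Block.zeta b.1 g)⁻¹ * (Block.zeta (b.1.conj g) h)⁻¹ := by
    rw [← Block.zeta_mul, mul_inv_rev]
  rw [lieAct_E, lieAct_E]
  simp only [map_sum, map_smul, lieAct_E, Finset.smul_sum, smul_smul, Block.Cl.conj_conj]
  rw [e]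
  simp only [← Block.zeta_mul, Block.coef_mul, Finset.sum_mul, Finset.mul_sum, Finset.sum_smul]
  have h1 : ∀ f : Fin (S s).dim → Fin (S s).dim → Fin (S s).dim → Fin (S s).dim → LieSum S,
      ∑ x, ∑ y, ∑ z, ∑ t, f x y z t = ∑ z, ∑ t, ∑ x, ∑ y, f x y z t := by
    intro f
    calc ∑ x, ∑ y, ∑ z, ∑ t, f x y z t = ∑ x, ∑ z, ∑ y, ∑ t, f x y z t :=
          Finset.sum_congr rfl fun x _ => Finset.sum_comm
      _ = ∑ z, ∑ x, ∑ y, ∑ t, f x y z t := Finset.sum_comm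
      _ = ∑ z, ∑ x, ∑ t, ∑ y, f x y z t :=
          Finset.sum_congr rfl fun z _ => Finset.sum_congr rfl fun x _ => Finset.sum_comm
      _ = ∑ z, ∑ t, ∑ x, ∑ y, f x y z t := Finset.sum_congr rfl fun z _ => Finset.sum_comm
  rw [h1]
  refine Finset.sum_congr rfl fun z _ => Finset.sum_congr rfl fun t _ => ?_
  refine Eq.trans ?_ Finset.sum_comm
  refine Finset.sum_congr rfl fun x _ => Finset.sum_congr rfl fun y _ => ?_
  congr 1
  ring

/-- The bracket against `g ▷ E_{cm}^{dl}`. -/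
theorem lieBracket_act (s : σ) (a b : (S s).Pt) (g : G) (t : σ) (c d : (S t).Pt) :
    lieBracket S (E S s a b ⊗ₜ[k] lieAct S g (E S t c d)) =
      if lieDeg (S := S) a b * (g * lieDeg (S := S) c d * g⁻¹)
          = b.1.1⁻¹ * (g * lieDeg (S := S) c d * g⁻¹) * b.1.1 then
        (S s).coef (Block.zeta a.1 (b.1.1⁻¹ * (g * lieDeg (S := S) c d * g⁻¹) * b.1.1)⁻¹)
          b.2 a.2 • lieAct S (b.1.1⁻¹ * g) (E S t c d)
      else 0 := by
  have hd : ∀ m l, lieDeg (S := S) (s := t) (c.1.conj g, m) (d.1.conj g, l)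
      = g * lieDeg (S := S) c d * g⁻¹ := by
    intro m l
    simp [lieDeg, Block.Cl.conj_val, mul_assoc]
  rw [← lieAct_mul_E, lieAct_E]
  simp only [TensorProduct.tmul_sum, TensorProduct.tmul_smul, map_sum, map_smul, lieBracket_E, hd]
  split_ifs
  · simp only [Finset.smul_sum]
    refine Finset.sum_congr rfl fun x _ => Finset.sum_congr rfl fun y _ => ?_
    rw [smul_comm]
  · simp

/-- The fundamental braiding is `Ψ̃(E_{ai}^{bj} ⊗ y) = b⁻¹ ▷ y ⊗ (|b⁻¹ ▷ y|⁻¹ ▷ E_{ai}) ⊗ E^{bj}`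
on basis elements `y`. -/
theorem fundBraid_E (s : σ) (a b : (S s).Pt) (t : σ) (c d : (S t).Pt) :
    fundBraid S (E S s a b ⊗ₜ[k] E S t c d) =
      lieAct S b.1.1⁻¹ (E S t c d) ⊗ₜ[k]
        ∑ m : Fin (S s).dim,
          (S s).coef (Block.zeta a.1 (b.1.1⁻¹ * lieDeg (S := S) c d * b.1.1)⁻¹) m a.2 •
            E S s (a.1.conj (b.1.1⁻¹ * lieDeg (S := S) c d * b.1.1)⁻¹, m) b := by
  have h1 : lieComul S (E S s a b) = ∑ e : (S s).Pt, E S s a e ⊗ₜ[k] E S s e b :=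
    lieLift_E S _ s a b
  have h2 : fundBraid S (E S s a b ⊗ₜ[k] E S t c d) = ∑ e : (S s).Pt,
      lieBracket S (E S s a e ⊗ₜ[k] lieAct S (lieDeg (S := S) e b) (E S t c d))
        ⊗ₜ[k] E S s e b := by
    simp [fundBraid, h1, TensorProduct.sum_tmul, lieBraid_E]
  rw [h2]
  set X := b.1.1⁻¹ * lieDeg (S := S) c d * b.1.1 with hX
  have e1 : ∀ e : (S s).Pt, e.1.1⁻¹ * (lieDeg (S := S) e b * lieDeg (S := S) c d *
      (lieDeg (S := S) e b)⁻¹) * e.1.1 = X := by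
    intro e
    simp [hX, lieDeg, mul_assoc]
  have e2 : ∀ e : (S s).Pt, e.1.1⁻¹ * lieDeg (S := S) e b = b.1.1⁻¹ := by
    intro e
    simp [lieDeg]
  have e3 : ∀ e : (S s).Pt, (lieDeg (S := S) a e * (lieDeg (S := S) e b * lieDeg (S := S) c d *
      (lieDeg (S := S) e b)⁻¹) = X) ↔ e.1 = a.1.conj X⁻¹ := by
    intro e
    have e4 : lieDeg (S := S) a e * (lieDeg (S := S) e b * lieDeg (S := S) c d *
      (lieDeg (S := S) e b)⁻¹) = a.1.1 * X * e.1.1⁻¹ := by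
      simp [hX, lieDeg, mul_assoc]
    rw [e4, Block.Cl.ext_iff, Block.Cl.conj_val, mul_inv_eq_iff_eq_mul]
    constructor
    · intro h
      rw [mul_assoc, inv_inv, h]
      group
    · intro h
      rw [h]
      group
  simp only [lieBracket_act, e1, e2, e3]
  rw [Fintype.sum_prod_type, Finset.sum_eq_single (a.1.conj X⁻¹)]
  · simp only [if_true, TensorProduct.tmul_sum, TensorProduct.tmul_smul, TensorProduct.smul_tmul']
  · intro e _ he
    simp [he]
  · simp

theorem rhoSharp_act (h : G) (s : σ) (a b : (S s).Pt) (g u : G) :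
    rhoSharp S (lieAct S h (E S s a b)) (g, u) =
      (S s).rElem a b (h⁻¹ * g * h, h⁻¹ * u * h) := by
  rw [lieAct_E]
  simp only [map_sum, map_smul, rhoSharp_E, DG.sum_apply, DG.smul_apply, Block.rElem_apply]
  have c1 : u = (b.1.conj h).1⁻¹ ↔ h⁻¹ * u * h = b.1.1⁻¹ := by
    rw [Block.Cl.conj_val]
    constructor
    · rintro rfl
      group
    · intro h1
      have : u = h * (h⁻¹ * u * h) * h⁻¹ := by group
      rw [this, h1]
      group
  have c2 : (a.1.conj h).conj g⁻¹ = b.1.conj h ↔ a.1.conj (h⁻¹ * g * h)⁻¹ = b.1 := by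
    rw [Block.Cl.conj_conj, Block.Cl.ext_iff, Block.Cl.ext_iff]
    simp only [Block.Cl.conj_val]
    constructor
    · intro h1
      have : b.1.1 = h⁻¹ * (h * b.1.1 * h⁻¹) * h := by group
      rw [this, ← h1]
      group
    · intro h1
      rw [← h1]
      group
  by_cases hc : u = (b.1.conj h).1⁻¹ ∧ (a.1.conj h).conj g⁻¹ = b.1.conj h
  · have hc' := hc
    rw [c1, c2] at hc'
    simp only [if_pos hc, if_pos hc']
    have e : Block.zeta a.1 (h⁻¹ * g * h)⁻¹ =
        (Block.zeta b.1 h)⁻¹ * (Block.zeta (a.1.conj h) g⁻¹ * Block.zeta a.1 h) := by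
      rw [Block.zeta_mul, eq_inv_mul_iff_mul_eq]
      have : Block.zeta b.1 h = Block.zeta (a.1.conj (h⁻¹ * g * h)⁻¹) h := by rw [hc'.2]
      rw [this, Block.zeta_mul]
      congr 1
      group
    rw [e, Block.coef_mul]
    simp only [Block.coef_mul, Finset.mul_sum]
    rw [Finset.sum_comm]
    refine Finset.sum_congr rfl fun x _ => Finset.sum_congr rfl fun y _ => ?_
    ring
  · have hc' := hc
    rw [c1, c2] at hc'
    rw [if_neg hc']
    simp only [if_neg hc, mul_zero, Finset.sum_const_zero]

theorem mul_rhoSharp_fundBraid (x y : LieSum S) :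
    LinearMap.mul' k (BDG k G) (TensorProduct.map (rhoSharp S) (rhoSharp S)
      (fundBraid S (x ⊗ₜ[k] y))) = rhoSharp S x * rhoSharp S y := by
  have key : ((LinearMap.mul' k (BDG k G)).comp (TensorProduct.map (rhoSharp S) (rhoSharp S))).comp
      (fundBraid S) =
      (LinearMap.mul' k (BDG k G)).comp (TensorProduct.map (rhoSharp S) (rhoSharp S)) := by
    refine TensorProduct.ext ?_
    refine (lieBasis S).ext fun ⟨s, a, b⟩ => (lieBasis S).ext fun ⟨t, c, d⟩ => ?_
    change LinearMap.mul' k (BDG k G) (TensorProduct.map (rhoSharp S) (rhoSharp S)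
      (fundBraid S (E S s a b ⊗ₜ[k] E S t c d))) =
      rhoSharp S (E S s a b) * rhoSharp S (E S t c d)
    rw [fundBraid_E, TensorProduct.map_tmul, LinearMap.mul'_apply, rhoSharp_E, rhoSharp_E]
    simp only [map_sum, map_smul, rhoSharp_E]
    refine DG.ext fun g h => ?_
    rw [DG.mul_apply, DG.mul_apply]
    simp only [rhoSharp_act, DG.sum_apply, DG.smul_apply]
    set X := b.1.1⁻¹ * lieDeg (S := S) c d * b.1.1 with hX
    rw [Finset.sum_eq_single (h * b.1.1), Finset.sum_eq_single b.1.1⁻¹]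
    · simp only [inv_inv]
      have e1 : b.1.1 * (h * b.1.1) * b.1.1⁻¹ = b.1.1 * h := by group
      rw [e1, mul_comm]
      by_cases hc : b.1.1 * h = d.1.1⁻¹ ∧ c.1.conj (b.1.1 * g * b.1.1⁻¹)⁻¹ = d.1
      · congr 1
        simp only [Block.rElem_apply]
        have hd := congrArg Block.Cl.val hc.2
        rw [Block.Cl.conj_val] at hd
        have hh : h = b.1.1⁻¹ * d.1.1⁻¹ := by rw [← hc.1]; group
        have e2 : ((h * b.1.1)⁻¹ * g * (h * b.1.1))⁻¹ * X⁻¹ = g⁻¹ := by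
          have hg : (h * b.1.1)⁻¹ * g * (h * b.1.1) = X⁻¹ * g := by
            rw [hX, hh, lieDeg, ← hd]
            group
          rw [hg]
          group
        have e3 : (h * b.1.1)⁻¹ * h = b.1.1⁻¹ := by group
        rw [e3]
        simp only [Block.Cl.conj_conj, e2]
        by_cases h4 : a.1.conj g⁻¹ = b.1
        · simp only [h4, and_self, if_true]
          rw [← e2, ← Block.zeta_mul, Block.coef_mul]
          exact Finset.sum_congr rfl fun m _ => mul_comm _ _
        · simp [h4]
      · rw [Block.rElem_apply, if_neg hc]
        simp
    · intro v _ hv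
      rw [Block.rElem_apply, if_neg (fun h => hv h.1), zero_mul]
    · simp
    · intro v _ hv
      have : v⁻¹ * h ≠ b.1.1⁻¹ := by
        intro h1
        apply hv
        rw [inv_mul_eq_iff_eq_mul] at h1
        rw [h1]
        group
      simp [Block.rElem_apply, this]
    · simp
  exact LinearMap.congr_fun key (x ⊗ₜ[k] y)

/-- The algebra map `U(𝓛) → BD(G)` extending `E_{ai}^{bj} ↦ r_{ai}^{bj}`. -/
def envMap : EnvAlg S →ₐ[k] BDG k G :=
  RingQuot.liftAlgHom k ⟨TensorAlgebra.lift k (rhoSharp S), by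
    rintro _ _ ⟨x, y⟩
    have h : ∀ z : LieSum S ⊗[k] LieSum S,
        TensorAlgebra.lift k (rhoSharp S) (LinearMap.mul' k _
          (TensorProduct.map (TensorAlgebra.ι k) (TensorAlgebra.ι k) z)) =
        LinearMap.mul' k (BDG k G) (TensorProduct.map (rhoSharp S) (rhoSharp S) z) := by
      intro z
      induction z with
      | zero => simp
      | tmul x y => simp
      | add x y hx hy => simp only [map_add, hx, hy]
    rw [h, mul_rhoSharp_fundBraid]
    simp⟩

theorem envMap_envOf (x : LieSum S) : envMap S (envOf S x) = rhoSharp S x := by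
  simp [envMap, envOf]

end Block

/-- A representation `ρ : H → A` of a bialgebra `H` is inner faithful if it does not factor through
any proper bialgebra quotient of `H`, i.e. every surjective bialgebra map `p : H → B` through which
`ρ` factors is injective. -/
def InnerFaithful {k : Type*} {H : Type v} {A : Type*} [Field k] [Ring H] [Bialgebra k H] [Ring A]
    [Algebra k A] (ρ : H →ₐ[k] A) : Prop :=
  ∀ (B : Type v) [Ring B] [Bialgebra k B] (p : H →ₐc[k] B), Function.Surjective p →
    (∃ f : B →ₐ[k] A, f.comp (p : H →ₐ[k] B) = ρ) → Function.Injective p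

end QuantumDouble

end

/-! Write `Q` for the bijection `factorisation` from `D(G)*` to `D(G)`. It sends matrix coefficients
of the blocks to the elements `r_{ai}^{bj}` (`Block.factorisation_coefficient`). These coefficients
span the space `M` of functionals vanishing on `ker ρ`, so the image of `U(𝓛)` is the subalgebra of
`D(G)` generated by `Q(M)`.

On the dual side, let `W` be the subalgebra of `D(G)*` generated by `M` under convolution. Its
annihilator is a bi-ideal inside `ker ρ`, and every functional in `W` is pulled back along any
bialgebra map through which `ρ` factors. By finite-dimensional duality, `ρ` is inner faithful
exactly when `W = D(G)*` (`innerFaithful_iff_coefficientAlgebra_eq_top`).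

It remains to compare the two generated algebras. `Q` is not multiplicative, but `Q(f) Q(f')` and
`Q(f * f')` differ only by a twist: split `f` into its components `f(δ_x ·)` and move the matching
second factor by the coadjoint action of `x` or `x⁻¹` (`factorisation_mul`,
`factorisation_convMul`). Since `ker ρ` is a two-sided ideal, `M` is stable under both operations.
Hence `Q(W)` is precisely the subalgebra generated by `Q(M)` (`adjoin_factorisation_eq_map`), and
bijectivity of `Q` gives the equivalence. -/

noncomputable section

namespace QuantumDouble

open WithConv

/-! ### Matrix coefficients of a bialgebra representation and their annihilator. -/

section CoefficientAlgebra

universe v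

variable {k : Type*} {H : Type v} {A : Type*} [Field k] [Ring H] [Bialgebra k H] [Ring A]
  [Algebra k A]

/-- The subalgebra of the convolution algebra `H*` generated by the functionals that vanish on the
kernel of the representation `ρ`. -/
def coefficientAlgebra (ρ : H →ₐ[k] A) : Subalgebra k (WithConv (H →ₗ[k] k)) :=
  Algebra.adjoin k {φ | ∀ x, ρ x = 0 → φ x = 0}

/-- If all two-sided translates of `f` and `g` lie in a subalgebra of `H*`, then so do those of
`f * g`. -/
theorem toConv_convMul_comp_mulLeftRight_mem (W : Subalgebra k (WithConv (H →ₗ[k] k)))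
    {f g : WithConv (H →ₗ[k] k)}
    (hf : ∀ p, toConv (f.ofConv ∘ₗ LinearMap.mulLeftRight k p) ∈ W)
    (hg : ∀ p, toConv (g.ofConv ∘ₗ LinearMap.mulLeftRight k p) ∈ W) (p : H × H) :
    toConv ((f * g).ofConv ∘ₗ LinearMap.mulLeftRight k p) ∈ W := by
  -- A translate of `f * g` by `(a, b)` is `x ↦ (f ⊗ g)(Δa Δx Δb)`. Letting arbitrary tensors
  -- replace `Δa` and `Δb` reduces the claim by bilinearity to pure tensors, where the functional is
  -- a convolution product of a translate of `f` and a translate of `g`.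
  have key : ∀ s t : H ⊗[k] H, toConv (
      (LinearMap.mul' k k ∘ₗ TensorProduct.map f.ofConv g.ofConv) ∘ₗ
      LinearMap.mulLeftRight k (s, t) ∘ₗ Coalgebra.comul) ∈ W := by
    generalize hF : LinearMap.mul' k k ∘ₗ TensorProduct.map f.ofConv g.ofConv = F
    intro s t
    induction s with
    | zero =>
      rw [show F ∘ₗ LinearMap.mulLeftRight k (0, t) ∘ₗ Coalgebra.comul = 0 from
        LinearMap.ext fun x => by simp [LinearMap.mulLeftRight_apply]]
      exact W.zero_mem
    | add s₁ s₂ h₁ h₂ =>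
      rw [show F ∘ₗ LinearMap.mulLeftRight k (s₁ + s₂, t) ∘ₗ Coalgebra.comul =
        F ∘ₗ LinearMap.mulLeftRight k (s₁, t) ∘ₗ Coalgebra.comul +
          F ∘ₗ LinearMap.mulLeftRight k (s₂, t) ∘ₗ Coalgebra.comul from
        LinearMap.ext fun x => by simp [LinearMap.mulLeftRight_apply, add_mul]]
      exact W.add_mem h₁ h₂
    | tmul a b =>
      induction t with
      | zero =>
        rw [show F ∘ₗ LinearMap.mulLeftRight k (a ⊗ₜ b, 0) ∘ₗ Coalgebra.comul = 0 from
          LinearMap.ext fun x => by simp [LinearMap.mulLeftRight_apply]]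
        exact W.zero_mem
      | add t₁ t₂ h₁ h₂ =>
        rw [show F ∘ₗ LinearMap.mulLeftRight k (a ⊗ₜ b, t₁ + t₂) ∘ₗ Coalgebra.comul =
          F ∘ₗ LinearMap.mulLeftRight k (a ⊗ₜ b, t₁) ∘ₗ Coalgebra.comul +
            F ∘ₗ LinearMap.mulLeftRight k (a ⊗ₜ b, t₂) ∘ₗ Coalgebra.comul from
          LinearMap.ext fun x => by simp [LinearMap.mulLeftRight_apply, mul_add]]
        exact W.add_mem h₁ h₂
      | tmul c d =>
        have e : TensorProduct.map f.ofConv g.ofConv ∘ₗ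
            LinearMap.mulLeftRight k (a ⊗ₜ[k] b, c ⊗ₜ[k] d) =
            TensorProduct.map (f.ofConv ∘ₗ LinearMap.mulLeftRight k (a, c))
              (g.ofConv ∘ₗ LinearMap.mulLeftRight k (b, d)) :=
          TensorProduct.ext' fun x y => by simp [LinearMap.mulLeftRight_apply]
        have := W.mul_mem (hf (a, c)) (hg (b, d))
        rwa [LinearMap.convMul_def, ofConv_toConv, ofConv_toConv, ← e, LinearMap.comp_assoc,
          ← LinearMap.comp_assoc, hF] at this
  obtain ⟨a, b⟩ := p
  have e : (f * g).ofConv ∘ₗ LinearMap.mulLeftRight k (a, b) =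
      (LinearMap.mul' k k ∘ₗ TensorProduct.map f.ofConv g.ofConv) ∘ₗ
        LinearMap.mulLeftRight k (Coalgebra.comul a, Coalgebra.comul b) ∘ₗ Coalgebra.comul := by
    refine LinearMap.ext fun x => ?_
    simp only [LinearMap.comp_apply, LinearMap.mulLeftRight_apply, LinearMap.convMul_apply,
      Bialgebra.comul_mul]
  rw [e]
  exact key _ _

/-- The generators are stable under translation because `ker ρ` is a two-sided ideal, and a
translate of the counit is a scalar multiple of it because the counit is multiplicative. This
stability is what makes the annihilator a two-sided ideal. -/
theorem toConv_comp_mulLeftRight_mem_coefficientAlgebra (ρ : H →ₐ[k] A)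
    {f : WithConv (H →ₗ[k] k)} (hf : f ∈ coefficientAlgebra ρ) (p : H × H) :
    toConv (f.ofConv ∘ₗ LinearMap.mulLeftRight k p) ∈ coefficientAlgebra ρ := by
  revert p
  induction hf using Algebra.adjoin_induction with
  | mem f hf =>
    intro p
    refine Algebra.subset_adjoin fun x hx => hf _ ?_
    rw [show LinearMap.mulLeftRight k p x = p.1 * x * p.2 from rfl, map_mul, map_mul, hx, mul_zero,
      zero_mul]
  | algebraMap c =>
    intro p
    convert (coefficientAlgebra ρ).algebraMap_mem
      (c * Coalgebra.counit p.1 * Coalgebra.counit p.2) using 1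
    ext x
    change c * Coalgebra.counit (p.1 * x * p.2)
      = c * Coalgebra.counit p.1 * Coalgebra.counit p.2 * Coalgebra.counit x
    rw [Bialgebra.counit_mul, Bialgebra.counit_mul]
    ring
  | add f g _ _ hf hg =>
    intro p
    exact (coefficientAlgebra ρ).add_mem (hf p) (hg p)
  | mul f g _ _ hf hg =>
    exact toConv_convMul_comp_mulLeftRight_mem _ hf hg

/-- The largest bi-ideal contained in the kernel of `ρ`. -/
def coefficientIdeal (ρ : H →ₐ[k] A) : Ideal H where
  carrier := {x | ∀ f ∈ coefficientAlgebra ρ, f x = 0}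
  zero_mem' f _ := map_zero f.ofConv
  add_mem' hx hy f hf := by rw [map_add, hx f hf, hy f hf, add_zero]
  smul_mem' a x hx f hf := by
    simpa [LinearMap.mulLeftRight_apply] using
      hx _ (toConv_comp_mulLeftRight_mem_coefficientAlgebra ρ hf (a, 1))

instance (ρ : H →ₐ[k] A) : (coefficientIdeal ρ).IsTwoSided where
  mul_mem_of_left {x} a hx f hf := by
    simpa [LinearMap.mulLeftRight_apply] using
      hx _ (toConv_comp_mulLeftRight_mem_coefficientAlgebra ρ hf (1, a))

/-- The functionals `φ ∘ ρ`, with `φ` in the dual of `A`, are generators, and the functionals on `A`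
separate its points. -/
theorem map_eq_zero_of_mem_coefficientIdeal {ρ : H →ₐ[k] A} {x : H}
    (hx : x ∈ coefficientIdeal ρ) : ρ x = 0 := by
  rw [← Module.forall_dual_apply_eq_zero_iff k]
  intro φ
  exact hx (toConv (φ ∘ₗ ρ.toLinearMap)) (Algebra.subset_adjoin fun y hy => by simp [hy])

/-! ### Inner faithfulness by finite-dimensional duality. -/

variable [FiniteDimensional k H]

/-- In finite dimension a subspace of the dual is its own double annihilator. -/
theorem mem_coefficientAlgebra_iff {ρ : H →ₐ[k] A} {f : WithConv (H →ₗ[k] k)} :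
    f ∈ coefficientAlgebra ρ ↔ ∀ x ∈ coefficientIdeal ρ, f x = 0 := by
  refine ⟨fun hf x hx => hx f hf, fun hf => ?_⟩
  let W : Submodule k (Module.Dual k H) :=
    (coefficientAlgebra ρ).toSubmodule.map (WithConv.linearEquiv k (H →ₗ[k] k)).toLinearMap
  have : FiniteDimensional k W :=
    FiniteDimensional.finiteDimensional_submodule (K := k) (V := Module.Dual k H) W
  have hW : f.ofConv ∈ W := by
    rw [← Subspace.dualCoannihilator_dualAnnihilator_eq (W := W), Submodule.mem_dualAnnihilator]
    intro x hx
    rw [Submodule.mem_dualCoannihilator] at hx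
    exact hf x fun g hg => hx g.ofConv (Submodule.mem_map_of_mem hg)
  obtain ⟨g, hg, hgf⟩ := hW
  rwa [← ofConv_injective hgf]

/-- The annihilator of a subalgebra of the dual is a coideal. The counit is the unit of that
subalgebra. For the coproduct, the dual of `(H ⧸ I) ⊗ (H ⧸ I)` is spanned by the tensors `f ⊗ g`;
pulled back to `H`, both `f` and `g` kill `I`, hence lie in the subalgebra, and so does their
convolution product, which therefore vanishes at `x`. -/
instance (ρ : H →ₐ[k] A) : ((coefficientIdeal ρ).restrictScalars k).IsCoideal where
  counit_eq_zero x hx := by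
    simpa using hx 1 (coefficientAlgebra ρ).one_mem
  map_mkQ_comul_eq_zero x hx := by
    set I := (coefficientIdeal ρ).restrictScalars k
    rw [← Module.forall_dual_apply_eq_zero_iff k]
    intro φ
    obtain ⟨t, rfl⟩ := (TensorProduct.dualDistribEquiv k (H ⧸ I) (H ⧸ I)).surjective φ
    induction t with
    | zero => simp
    | add s t hs ht => simp only [map_add, LinearMap.add_apply, hs, ht, add_zero]
    | tmul f g =>
      have hI : ∀ φ : Module.Dual k (H ⧸ I), toConv (φ ∘ₗ I.mkQ) ∈ coefficientAlgebra ρ := by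
        intro φ
        rw [mem_coefficientAlgebra_iff]
        intro y hy
        have : I.mkQ y = 0 := (Submodule.Quotient.mk_eq_zero I).mpr hy
        simp [-Submodule.mkQ_apply, this]
      have := hx _ ((coefficientAlgebra ρ).mul_mem (hI f) (hI g))
      rw [LinearMap.convMul_apply, TensorProduct.map_comp] at this
      generalize TensorProduct.map I.mkQ I.mkQ = F at *
      rw [LinearMap.comp_apply] at this
      rw [← this]
      generalize F _ = z
      induction z with
      | zero => simp
      | add s t hs ht => simp only [map_add, hs, ht]
      | tmul a b => simp [TensorProduct.dualDistribEquiv, TensorProduct.dualDistribEquivOfBasis]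

/-- A representation of a finite dimensional bialgebra is inner faithful if and only if its matrix
coefficients generate the dual bialgebra. -/
theorem innerFaithful_iff_coefficientAlgebra_eq_top (ρ : H →ₐ[k] A) :
    InnerFaithful ρ ↔ coefficientAlgebra ρ = ⊤ := by
  constructor
  · intro h
    -- Inner faithfulness applied to the quotient by the annihilator forces the annihilator to be
    -- zero.
    have hinj := h (H ⧸ coefficientIdeal ρ) (Bialgebra.Quotient.mkBialgHom _)
      Ideal.Quotient.mk_surjective
      ⟨Ideal.Quotient.liftₐ _ ρ fun _ => map_eq_zero_of_mem_coefficientIdeal, rfl⟩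
    rw [eq_top_iff]
    intro f _
    rw [mem_coefficientAlgebra_iff]
    intro x hx
    have : x = 0 := hinj <| by
      rw [map_zero, Bialgebra.Quotient.mkBialgHom_apply, Ideal.Quotient.eq_zero_iff_mem]
      exact hx
    rw [this, map_zero]
  · rintro h B _ _ p - ⟨f, hf⟩
    rw [injective_iff_map_eq_zero]
    intro x hx
    -- Functionals pulled back along the coalgebra map `p` are closed under convolution. If they
    -- exhaust the dual of `H`, every functional kills `ker p`, so `ker p = 0`.
    have key : ∀ g ∈ coefficientAlgebra ρ, ∃ φ : B →ₗ[k] k,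
        g = toConv (φ ∘ₗ (p : H →ₗc[k] B).toLinearMap) := by
      intro g hg
      induction hg using Algebra.adjoin_induction with
      | mem g hg =>
        -- Since `ρ` factors through `p`, `ker p ⊆ ker ρ`. A functional vanishing on `ker p` comes
        -- from one on `B`.
        have : g.ofConv ∈ LinearMap.range (p : H →ₗc[k] B).toLinearMap.dualMap := by
          rw [LinearMap.range_dualMap_eq_dualAnnihilator_ker, Submodule.mem_dualAnnihilator]
          intro y hy
          have hy : p y = 0 := hy
          refine hg y ?_
          rw [← hf]
          simp [hy]
        obtain ⟨φ, hφ⟩ := this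
        exact ⟨φ, ofConv_injective hφ.symm⟩
      | algebraMap c =>
        refine ⟨c • Coalgebra.counit, ?_⟩
        ext y
        simp
      | add g₁ g₂ _ _ h₁ h₂ =>
        obtain ⟨φ₁, rfl⟩ := h₁
        obtain ⟨φ₂, rfl⟩ := h₂
        exact ⟨φ₁ + φ₂, rfl⟩
      | mul g₁ g₂ _ _ h₁ h₂ =>
        obtain ⟨φ₁, rfl⟩ := h₁
        obtain ⟨φ₂, rfl⟩ := h₂
        exact ⟨(toConv φ₁ * toConv φ₂).ofConv, ofConv_injective
          (LinearMap.convMul_comp_coalgHom_distrib (toConv φ₁) (toConv φ₂) (p : H →ₗc[k] B)).symm⟩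
    rw [← Module.forall_dual_apply_eq_zero_iff k]
    intro g
    obtain ⟨φ, hφ⟩ := key (toConv g) (h ▸ Algebra.mem_top)
    rw [show g = φ ∘ₗ (p : H →ₗc[k] B).toLinearMap from toConv_injective hφ]
    change φ (p x) = 0
    rw [hx, map_zero]

end CoefficientAlgebra

/-! ### The factorisation map of `D(G)` and its failure to be multiplicative. -/

section Factorisation

variable {k G : Type*} [Field k] [Group G] [Fintype G] [DecidableEq G]

instance : FiniteDimensional k (DG k G) := Module.Finite.of_basis (dgBasis k G)

/-- The element `1 ⊗ x` of `D(G)`. -/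
def groupElem (k : Type*) {G : Type*} [Field k] [DecidableEq G] (x : G) : DG k G :=
  fun p => if p.2 = x then 1 else 0

theorem groupElem_apply (x g h : G) : groupElem k x (g, h) = if h = x then 1 else 0 := rfl

theorem groupElem_mul_apply (x : G) (y : DG k G) (g h : G) :
    (groupElem k x * y) (g, h) = y (x⁻¹ * g * x, x⁻¹ * h) := by
  rw [DG.mul_apply, Finset.sum_eq_single x]
  · simp [groupElem_apply]
  · intro v _ hv
    simp [groupElem_apply, hv]
  · simp

theorem mul_groupElem_apply (x : G) (y : DG k G) (g h : G) :
    (y * groupElem k x) (g, h) = y (g, h * x⁻¹) := by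
  rw [DG.mul_apply, Finset.sum_eq_single (h * x⁻¹)]
  · simp [groupElem_apply]
  · intro v _ hv
    rw [groupElem_apply, if_neg, mul_zero]
    rintro rfl
    exact hv (by group)
  · simp

theorem groupElem_mul_groupElem_inv (x : G) : groupElem k x * groupElem k x⁻¹ = 1 := by
  refine DG.ext fun g h => ?_
  rw [groupElem_mul_apply, groupElem_apply, DG.one_apply]
  simp

theorem groupElem_mul_dg_mul_groupElem_inv (x u v : G) :
    groupElem k x * dg k u v * groupElem k x⁻¹ = dg k (x * u * x⁻¹) (x * v * x⁻¹) := by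
  refine DG.ext fun g h => ?_
  rw [mul_groupElem_apply, groupElem_mul_apply, dg_apply, dg_apply]
  refine if_congr (and_congr ?_ ?_) rfl rfl
  · constructor
    · rintro rfl
      group
    · rintro rfl
      group
  · constructor
    · rintro rfl
      group
    · rintro rfl
      group

/-- The component `f(δ_x ·)` of a functional on `D(G)`. -/
def component (x : G) (f : WithConv (DG k G →ₗ[k] k)) : WithConv (DG k G →ₗ[k] k) :=
  toConv (f.ofConv ∘ₗ LinearMap.mulLeftRight k (dg k x 1, 1))

/-- The coadjoint translate `f(x · x⁻¹)` of a functional on `D(G)`. -/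
def coadjoint (x : G) (f : WithConv (DG k G →ₗ[k] k)) : WithConv (DG k G →ₗ[k] k) :=
  toConv (f.ofConv ∘ₗ LinearMap.mulLeftRight k (groupElem k x, groupElem k x⁻¹))

theorem component_dg (x u v : G) (f : WithConv (DG k G →ₗ[k] k)) :
    component x f (dg k u v) = if x = u then f (dg k x v) else 0 := by
  change f (dg k x 1 * dg k u v * 1) = _
  rw [mul_one, dg_mul_dg]
  simp only [one_mul, inv_one, mul_one]
  rw [apply_ite f.ofConv, map_zero]

theorem coadjoint_dg (x u v : G) (f : WithConv (DG k G →ₗ[k] k)) :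
    coadjoint x f (dg k u v) = f (dg k (x * u * x⁻¹) (x * v * x⁻¹)) := by
  rw [← groupElem_mul_dg_mul_groupElem_inv]
  rfl

theorem functional_ext {f g : WithConv (DG k G →ₗ[k] k)}
    (h : ∀ u v, f (dg k u v) = g (dg k u v)) : f = g :=
  ofConv_injective ((dgBasis k G).ext fun p => h p.1 p.2)

theorem sum_component (f : WithConv (DG k G →ₗ[k] k)) : ∑ x, component x f = f :=
  functional_ext fun u v => by simp [component_dg]

theorem coadjoint_coadjoint_inv (x : G) (f : WithConv (DG k G →ₗ[k] k)) :
    coadjoint x (coadjoint x⁻¹ f) = f :=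
  functional_ext fun u v => by
    rw [coadjoint_dg, coadjoint_dg]
    congr 2 <;> group

theorem convMul_apply_dg (f f' : WithConv (DG k G →ₗ[k] k)) (g h : G) :
    (f * f') (dg k g h) = ∑ a : G, f (dg k a h) * f' (dg k (a⁻¹ * g) h) := by
  rw [LinearMap.convMul_apply, show Coalgebra.comul (R := k) (dg k g h) = _ from dgComul_dg g h]
  simp

/-- The isomorphism `D(G)* → D(G)`, `f ↦ (f ⊗ id)(R₂₁ R)`, that expresses that `D(G)` is
factorisable. -/
def factorisation (k G : Type*) [Field k] [Group G] [Fintype G] [DecidableEq G] :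
    WithConv (DG k G →ₗ[k] k) →ₗ[k] DG k G where
  toFun f := fun p => f (dg k p.2⁻¹ p.1⁻¹)
  map_add' _ _ := rfl
  map_smul' _ _ := rfl

theorem factorisation_apply (f : WithConv (DG k G →ₗ[k] k)) (g h : G) :
    factorisation k G f (g, h) = f (dg k h⁻¹ g⁻¹) := rfl

/-- In coordinates the map only permutes the basis labels, by the involution `(g, h) ↦ (h⁻¹, g⁻¹)`.
-/
theorem factorisation_bijective : Function.Bijective (factorisation k G) := by
  refine ⟨fun f f' hff => functional_ext fun u v => ?_, fun x => ?_⟩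
  · have := congrFun hff (v⁻¹, u⁻¹)
    rwa [factorisation_apply, factorisation_apply, inv_inv, inv_inv] at this
  · refine ⟨toConv ((dgBasis k G).constr k fun p => x (p.2⁻¹, p.1⁻¹)), DG.ext fun g h => ?_⟩
    rw [factorisation_apply]
    refine ((dgBasis k G).constr_basis k _ (h⁻¹, g⁻¹)).trans ?_
    simp

theorem factorisation_one : factorisation k G 1 = 1 :=
  DG.ext fun g h => by
    rw [factorisation_apply, DG.one_apply, LinearMap.convOne_apply]
    refine (dgCounit_dg h⁻¹ g⁻¹).trans ?_
    simp

/-- Equivariance turns coadjoint twists of functionals into conjugations in `D(G)`, under which a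
subalgebra can be tested on generators. -/
theorem factorisation_coadjoint (x : G) (f : WithConv (DG k G →ₗ[k] k)) :
    factorisation k G (coadjoint x f)
      = groupElem k x⁻¹ * factorisation k G f * groupElem k x := by
  refine DG.ext fun g h => ?_
  rw [mul_groupElem_apply, groupElem_mul_apply, factorisation_apply, factorisation_apply,
    coadjoint_dg]
  congr 2 <;> group

/-- The component at `x` is supported on `δ_x`, so the sums defining the product of `D(G)` and the
convolution each collapse to one term: `v = x⁻¹` in the former, `a = x` in the latter. The
conjugation by `v` in the product of `D(G)` becomes the coadjoint translate of `f'`. -/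
theorem factorisation_component_mul (x : G) (f f' : WithConv (DG k G →ₗ[k] k)) :
    factorisation k G (component x f) * factorisation k G f'
      = factorisation k G (component x f * coadjoint x f') := by
  refine DG.ext fun g h => ?_
  rw [DG.mul_apply, factorisation_apply, convMul_apply_dg]
  refine Fintype.sum_equiv (Equiv.inv G) _ _ fun v => ?_
  rw [factorisation_apply, factorisation_apply, coadjoint_dg, Equiv.inv_apply, component_dg]
  split_ifs with hx
  · subst hx
    congr 3 <;> group
  · simp

theorem factorisation_mul (f f' : WithConv (DG k G →ₗ[k] k)) :
    factorisation k G f * factorisation k G f'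
      = factorisation k G (∑ x, component x f * coadjoint x f') := by
  conv_lhs => rw [← sum_component f]
  simp only [map_sum, Finset.sum_mul, factorisation_component_mul]

/-- This inverts the twist in `factorisation_mul`, expressing convolution through the product of
`D(G)`. The two formulas give the two inclusions in the comparison of generated subalgebras. -/
theorem factorisation_convMul (f f' : WithConv (DG k G →ₗ[k] k)) :
    factorisation k G (f * f')
      = ∑ x, factorisation k G (component x f) * factorisation k G (coadjoint x⁻¹ f') := by
  conv_lhs => rw [← sum_component f]
  simp only [map_sum, Finset.sum_mul, factorisation_component_mul, coadjoint_coadjoint_inv]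

/-! ### Comparison of the subalgebras generated in `D(G)` and in `D(G)*`. -/

variable {A : Type*} [Ring A] [Algebra k A]

/-- Components and coadjoint translates of a generator are again generators, not merely elements of
the generated algebra. -/
theorem comp_mulLeftRight_apply_eq_zero {ρ : DG k G →ₐ[k] A} {f : WithConv (DG k G →ₗ[k] k)}
    (hf : ∀ x, ρ x = 0 → f x = 0) (p : DG k G × DG k G) (x : DG k G) (hx : ρ x = 0) :
    toConv (f.ofConv ∘ₗ LinearMap.mulLeftRight k p) x = 0 :=
  hf (p.1 * x * p.2) (by rw [map_mul, map_mul, hx, mul_zero, zero_mul])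

/-- The subalgebra of `D(G)` generated by the image of the functionals vanishing on the kernel of
`ρ` is the image of the subalgebra of `D(G)*` that they generate. -/
theorem adjoin_factorisation_eq_map (ρ : DG k G →ₐ[k] A) :
    Subalgebra.toSubmodule
        (Algebra.adjoin k (factorisation k G '' {f | ∀ x, ρ x = 0 → f x = 0})) =
      (Subalgebra.toSubmodule (coefficientAlgebra ρ)).map (factorisation k G) := by
  set 𝒜 := Algebra.adjoin k (factorisation k G '' {f | ∀ x, ρ x = 0 → f x = 0}) with h𝒜
  apply le_antisymm
  · intro a ha
    rw [Subalgebra.mem_toSubmodule] at ha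
    simp only [Submodule.mem_map, Subalgebra.mem_toSubmodule]
    induction ha using Algebra.adjoin_induction with
    | mem a ha =>
      obtain ⟨f, hf, rfl⟩ := ha
      exact ⟨f, Algebra.subset_adjoin hf, rfl⟩
    | algebraMap c =>
      refine ⟨algebraMap k _ c, Subalgebra.algebraMap_mem _ c, ?_⟩
      rw [Algebra.algebraMap_eq_smul_one, map_smul, factorisation_one,
        Algebra.algebraMap_eq_smul_one]
    | add a b _ _ ha hb =>
      obtain ⟨f, hf, rfl⟩ := ha
      obtain ⟨g, hg, rfl⟩ := hb
      exact ⟨f + g, add_mem hf hg, map_add _ _ _⟩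
    | mul a b _ _ ha hb =>
      obtain ⟨f, hf, rfl⟩ := ha
      obtain ⟨g, hg, rfl⟩ := hb
      exact ⟨_, sum_mem fun x _ => mul_mem
        (toConv_comp_mulLeftRight_mem_coefficientAlgebra ρ hf _)
        (toConv_comp_mulLeftRight_mem_coefficientAlgebra ρ hg _), (factorisation_mul f g).symm⟩
  -- Conjugation by `x⁻¹` is an algebra automorphism that permutes the images of the generators, by
  -- `factorisation_coadjoint`.
  · have hconj : ∀ x : G, ∀ a ∈ 𝒜, groupElem k x⁻¹ * a * groupElem k x ∈ 𝒜 := by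
      intro x a ha
      have h1 : groupElem k x * groupElem k x⁻¹ = 1 := groupElem_mul_groupElem_inv x
      have h2 : groupElem k x⁻¹ * groupElem k x = 1 := by
        simpa using groupElem_mul_groupElem_inv (k := k) x⁻¹
      induction ha using Algebra.adjoin_induction with
      | mem a ha =>
        obtain ⟨f, hf, rfl⟩ := ha
        rw [← factorisation_coadjoint]
        exact Algebra.subset_adjoin ⟨_, comp_mulLeftRight_apply_eq_zero hf _, rfl⟩
      | algebraMap c =>
        rw [← Algebra.commutes, mul_assoc, h2, mul_one]
        exact Subalgebra.algebraMap_mem _ c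
      | add a b _ _ ha hb =>
        rw [mul_add, add_mul]
        exact add_mem ha hb
      | mul a b _ _ ha hb =>
        have : groupElem k x⁻¹ * (a * b) * groupElem k x =
            (groupElem k x⁻¹ * a * groupElem k x) * (groupElem k x⁻¹ * b * groupElem k x) := by
          calc
            _ = groupElem k x⁻¹ * a * 1 * b * groupElem k x := by simp only [mul_assoc, mul_one]
            _ = _ := by rw [← h1]; simp only [mul_assoc]
        rw [this]
        exact mul_mem ha hb
    -- As the map is not multiplicative, the induction on `f` needs a statement about left
    -- convolution by `f` on an arbitrary `g` with image in `𝒜`. For a generator `f`, the components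
    -- of `f` are generators and the twisted `g` has as image a conjugate of the image of `g`;
    -- products are handled by associativity. The choice `g = 1` concludes.
    have hmul : ∀ f ∈ coefficientAlgebra ρ, ∀ g, factorisation k G g ∈ 𝒜 →
        factorisation k G (f * g) ∈ 𝒜 := by
      intro f hf
      induction hf using Algebra.adjoin_induction with
      | mem f hf =>
        intro g hg
        rw [factorisation_convMul]
        refine sum_mem fun x _ => mul_mem
          (Algebra.subset_adjoin ⟨_, comp_mulLeftRight_apply_eq_zero hf _, rfl⟩) ?_
        rw [factorisation_coadjoint]
        exact hconj x⁻¹ _ hg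
      | algebraMap c =>
        intro g hg
        rw [Algebra.algebraMap_eq_smul_one, smul_mul_assoc, one_mul, map_smul]
        exact Subalgebra.smul_mem _ hg c
      | add f f' _ _ hf hf' =>
        intro g hg
        rw [add_mul, map_add]
        exact add_mem (hf g hg) (hf' g hg)
      | mul f f' _ _ hf hf' =>
        intro g hg
        rw [mul_assoc]
        exact hf _ (hf' g hg)
    rintro _ ⟨f, hf, rfl⟩
    have := hmul f hf 1 (by rw [factorisation_one]; exact one_mem _)
    rwa [mul_one] at this

theorem adjoin_factorisation_eq_top_iff (ρ : DG k G →ₐ[k] A) :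
    Algebra.adjoin k (factorisation k G '' {f | ∀ x, ρ x = 0 → f x = 0}) = ⊤ ↔
      InnerFaithful ρ := by
  rw [innerFaithful_iff_coefficientAlgebra_eq_top, ← Algebra.toSubmodule_eq_top,
    ← Algebra.toSubmodule_eq_top, adjoin_factorisation_eq_map]
  constructor
  · intro h
    have := congrArg (Submodule.comap (factorisation k G)) h
    rwa [Submodule.comap_map_eq_of_injective factorisation_bijective.1, Submodule.comap_top] at this
  · intro h
    rw [h, Submodule.map_top, LinearMap.range_eq_top]
    exact factorisation_bijective.2

end Factorisation

/-! ### The generators `r_{ai}^{bj}` as images of matrix coefficients. -/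

namespace Block

universe u v w

variable {k : Type u} {G : Type v} [Field k] [Group G] [Fintype G] [DecidableEq G]
  {T : Transversal G}

theorem rho_dg (X : Block.{u, v, w} k T) (g h : G) : X.rho (dg k g h) = X.mat g h :=
  (dgBasis k G).constr_basis k _ (g, h)

/-- The matrix coefficients of `ρ_{C,π}`. -/
def coefficient (X : Block.{u, v, w} k T) (a b : X.Pt) : DG k G →ₗ[k] k :=
  Matrix.entryLinearMap k k a b ∘ₗ X.rho.toLinearMap

theorem coefficient_apply (X : Block.{u, v, w} k T) (a b : X.Pt) (x : DG k G) :
    X.coefficient a b x = X.rho x a b := rfl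

/-- Both sides are supported where `h = b⁻¹` and `g⁻¹ a g = b`, with value an entry of
`π(ζ_a(g⁻¹))`. The indices are transposed: the lower index of `r` is the column of the coefficient.
-/
theorem factorisation_coefficient (X : Block.{u, v, w} k T) (a b : X.Pt) :
    factorisation k G (toConv (X.coefficient b a)) = X.rElem a b := by
  refine DG.ext fun g h => ?_
  rw [factorisation_apply, ofConv_toConv, coefficient_apply, rho_dg, rElem_apply, mat,
    Matrix.of_apply]
  refine if_congr (and_congr ?_ eq_comm) rfl rfl
  rw [inv_eq_iff_eq_inv]

variable {σ : Type*} [Fintype σ] [DecidableEq σ] (S : σ → Block.{u, v, w} k T)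

theorem rhoSum_eq_zero_iff (x : DG k G) : rhoSum S x = 0 ↔ ∀ s, (S s).rho x = 0 := by
  have h : ∀ f s, rhoSum S x f s = Matrix.mulVec ((S s).rho x) (f s) := fun _ _ => rfl
  constructor
  · intro hx s
    refine Matrix.ext_of_mulVec_single fun a => ?_
    -- A standard basis vector placed in the block `s` reads off one column of `(S s).rho x`.
    have := congrFun (LinearMap.congr_fun hx (Pi.single s (Pi.single a 1))) s
    rw [h, Pi.single_eq_same] at this
    rw [this, Matrix.zero_mulVec]
    rfl
  · intro hx
    refine LinearMap.ext fun f => funext fun s => ?_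
    rw [h, hx, Matrix.zero_mulVec]
    rfl

/-- The kernel of `ρ` is the common kernel of the finitely many matrix coefficients of the blocks,
and a functional vanishing on a finite intersection of kernels is a linear combination of the
functionals involved. -/
theorem setOf_vanishing_rhoSum :
    {f : WithConv (DG k G →ₗ[k] k) | ∀ x, rhoSum S x = 0 → f x = 0} =
      Submodule.span k (Set.range fun i : Σ s, (S s).Pt × (S s).Pt =>
        toConv ((S i.1).coefficient i.2.2 i.2.1)) := by
  apply Set.Subset.antisymm
  · intro f hf
    have := mem_span_of_iInf_ker_le_ker (K := f.ofConv)
      (L := fun i : Σ s, (S s).Pt × (S s).Pt => (S i.1).coefficient i.2.2 i.2.1) (by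
        intro x hx
        rw [Submodule.mem_iInf] at hx
        refine hf x ((rhoSum_eq_zero_iff S x).mpr fun s => ?_)
        ext a b
        exact hx ⟨s, b, a⟩)
    have h := Submodule.mem_map_of_mem
      (f := (WithConv.linearEquiv k (DG k G →ₗ[k] k)).symm.toLinearMap) this
    rw [Submodule.map_span, ← Set.range_comp] at h
    exact h
  · intro f hf x hx
    rw [rhoSum_eq_zero_iff] at hx
    induction hf using Submodule.span_induction with
    | mem f hf =>
      obtain ⟨⟨s, a, b⟩, rfl⟩ := hf
      rw [ofConv_toConv, coefficient_apply, hx]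
      rfl
    | zero => rfl
    | add f g _ _ hf hg => rw [ofConv_add, LinearMap.add_apply, hf, hg, add_zero]
    | smul c f _ hf => rw [ofConv_smul, LinearMap.smul_apply, hf, smul_zero]

theorem range_rhoSharp :
    Set.range (rhoSharp S) = factorisation k G '' {f | ∀ x, rhoSum S x = 0 → f x = 0} := by
  rw [setOf_vanishing_rhoSum, ← Submodule.map_coe, Submodule.map_span, ← Set.range_comp,
    ← LinearMap.coe_range, LinearMap.range_eq_map, ← (lieBasis S).span_eq, Submodule.map_span,
    ← Set.range_comp]
  refine congrArg (fun f => ((Submodule.span k (Set.range f) : Submodule k (DG k G)) : Set (DG k G))) ?_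
  funext ⟨s, a, b⟩
  exact (rhoSharp_E S s a b).trans (factorisation_coefficient _ a b).symm

/-- `U(𝓛)` is a quotient of the tensor algebra, so its relations do not affect the image, which is
generated by the image of `𝓛`. -/
theorem range_envMap : (envMap S).range = Algebra.adjoin k (Set.range (rhoSharp S)) := by
  have h : (envMap S).comp (RingQuot.mkAlgHom k (EnvRel S)) = TensorAlgebra.lift k (rhoSharp S) :=
    TensorAlgebra.hom_ext (LinearMap.ext fun x => by
      simpa [envOf] using envMap_envOf S x)
  have h1 : (envMap S).range = (TensorAlgebra.lift k (rhoSharp S)).range := by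
    rw [← h]
    apply SetLike.coe_injective
    rw [AlgHom.coe_range, AlgHom.coe_range, AlgHom.coe_comp,
      (RingQuot.mkAlgHom_surjective k (EnvRel S)).range_comp]
  rw [h1, ← Algebra.map_top, ← TensorAlgebra.adjoin_range_ι, AlgHom.map_adjoin, ← Set.range_comp]
  refine congrArg (fun f => Algebra.adjoin k (Set.range f)) ?_
  funext x
  simp

end Block

end QuantumDouble

end
/-- The algebra map `U(𝓛) → BD(G)` extending `E_{ai}^{bj} ↦ r_{ai}^{bj}` is surjective if and only if
the representation `ρ` of `D(G)` on the sum of the blocks is inner faithful. -/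
theorem mainTheorem10 {k G σ : Type*} [Field k] [Group G] [Fintype G] [DecidableEq G]
    [Fintype σ] [DecidableEq σ] (T : QuantumDouble.Transversal G)
    (S : σ → QuantumDouble.Block k T) (hnontrivial : ∀ s, ¬ (S s).IsTrivial)
    (hdistinct : ∀ s t, s ≠ t → ¬ (S s).Iso (S t)) :
    Function.Surjective (QuantumDouble.envMap S) ↔
      QuantumDouble.InnerFaithful (QuantumDouble.rhoSum S) := by
  rw [← AlgHom.range_eq_top, QuantumDouble.Block.range_envMap, QuantumDouble.Block.range_rhoSharp,
    QuantumDouble.adjoin_factorisation_eq_top_iff]
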